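/- Let $\mathbb{H}$ be the hyperbolic plane (curvature $-1$) with distance $d_{\mathbb{H}}$ and area measure $A_{\mathbb{H}}$, let $0\in\mathbb{H}$ be a fixed point, and let $\lambda>0$. Let $\Pi^\lambda=\Pi_0^\lambda\cup\{0\}$, where $\Pi_0^\lambda$ is a Poisson point process on $\mathbb{H}$ with intensity measure $\lambda\,A_{\mathbb{H}}$ (that is, $\Pi^\lambda$ is the Poisson process conditioned to contain $0$). For $p\in\Pi^\lambda$, the Voronoi cell with nucleus $p$ is $\{z\in\mathbb{H}: d_{\mathbb{H}}(z,p)=\min_{q\in\Pi^\lambda}d_{\mathbb{H}}(z,q)\}$. Let $G=\mathscr{V}^\lambda$ be the dual graph of this tessellation: its vertex set is $\Pi^\lambda$, and two distinct nuclei are adjacent if and only if their cells share a boundary arc. Let $B_G(0,r)$ be the closed ball of radius $r$ around the vertex $0$ in the graph metric of $G$. Then, almost surely, $$\limsup_{r\to\infty}|B_G(0,r)|^{1/r}<\infty .$$ -/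

import Mathlib

open MeasureTheory ProbabilityTheory
open scoped NNReal ENNReal UpperHalfPlane

/-- `N` is (the set of points of) a Poisson point process on `X` with the diffuse intensity
measure `ν`: the number of points in a measurable set of finite intensity is a Poisson random
variable with the intensity of the set as its mean, and the numbers of points in pairwise disjoint
measurable sets are independent. -/
structure IsPoissonProcess {X Ω : Type*} [MeasurableSpace X] [MeasurableSpace Ω]
    (ν : Measure X) (P : Measure Ω) (N : Ω → Set X) : Prop where
  measurable_count : ∀ A : Set X, MeasurableSet A → Measurable fun ω => (N ω ∩ A).encard
  map_count : ∀ A : Set X, MeasurableSet A → ν A ≠ ⊤ →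
    P.map (fun ω => (N ω ∩ A).encard) =
      (poissonMeasure (ν A).toNNReal).map (fun k : ℕ => (k : ℕ∞))
  indep_count : ∀ (n : ℕ) (A : Fin n → Set X), (∀ i, MeasurableSet (A i)) →
    Pairwise (fun i j => Disjoint (A i) (A j)) →
    iIndepFun (fun i ω => (N ω ∩ A i).encard) P

/-- The Voronoi cell with nucleus `p`, for the set of nuclei `S` in the hyperbolic plane. The
hyperbolic plane is the upper half-plane `ℍ` with its metric of curvature `-1`. -/
def voronoiCell (S : Set ℍ) (p : ℍ) : Set ℍ :=
  {z | ∀ q ∈ S, dist z p ≤ dist z q}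

/-- The dual graph of the Voronoi tessellation with nuclei `S`. Its vertices are the nuclei (one
for each cell), and two of them are adjacent if and only if the boundaries of their cells have an
arc (a homeomorphic image of the unit interval) in common. -/
def voronoiDualGraph (S : Set ℍ) : SimpleGraph S where
  Adj p q := p ≠ q ∧ ∃ γ : unitInterval → ℍ, Continuous γ ∧ Function.Injective γ ∧
    ∀ t, γ t ∈ frontier (voronoiCell S p) ∩ frontier (voronoiCell S q)
  symm := ⟨fun _ _ h => ⟨h.1.symm, h.2.imp fun _ hγ =>
    ⟨hγ.1, hγ.2.1, fun t => ⟨(hγ.2.2 t).2, (hγ.2.2 t).1⟩⟩⟩⟩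
  loopless := ⟨fun _ h => h.1 rfl⟩

/-- The closed ball of radius `r` around `v` in the graph metric, in which vertices of different
components are at distance `⊤`. -/
def SimpleGraph.closedBall {V : Type*} (G : SimpleGraph V) (v : V) (r : ℕ) : Set V :=
  {w | G.edist v w ≤ r}

/-! ### Area bounds for hyperbolic balls. -/

namespace UpperHalfPlane

/-! Adjacent nuclei lie on the boundary of a disk without nuclei, so a graph path of at most `r`
edges ending far from `o` forces at most `r` empty disks of large total radius. Moving their centres
to a net and applying Vitali gives disjoint empty balls, consecutive ones at distance linear in
their sizes (`exists_voidChain`).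

A union bound controls such chains (`measure_voidChain_le`). Disjoint balls have additive area, so
the void probability is a product. A ball of size `k` costs `exp (-lam * area)` with area at least
quadratic in `k`, which beats both the `exp (O(k))` choices of the next centre and a further weight
`exp k`. Hence a chain of `m` balls of total size `M` has probability at most `C ^ m * exp (-M)`.
With `M` a large multiple of `r`, Borel–Cantelli puts the graph ball inside a hyperbolic ball of
radius `K * r`; Markov and Borel–Cantelli bound the number of points there by an exponential in `r`.
-/

theorem volume_closedBall_le (z : ℍ) (R : ℝ) :
    volume (Metric.closedBall z R) ≤ ENNReal.ofReal (4 * Real.exp (4 * R)) := by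
  have hz := z.im_pos
  have hsub : (UpperHalfPlane.coe '' Metric.closedBall z R) ⊆
      Metric.closedBall (z : ℂ) (z.im * Real.exp R) := by
    rintro _ ⟨w, hw, rfl⟩
    have hw : dist w z ≤ R := hw
    refine (dist_coe_le w z).trans ?_
    gcongr
    have := Real.exp_le_exp.2 hw
    linarith
  rw [volume_eq_lintegral]
  -- Crude bound: largest area density on the ball times the area of the enclosing Euclidean disk.
  calc _ ≤ ∫⁻ w : ℂ in UpperHalfPlane.coe '' Metric.closedBall z R,
        ENNReal.ofReal ((Real.exp R / z.im) ^ 2) := by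
        refine setLIntegral_mono measurable_const ?_
        rintro _ ⟨w, hw, rfl⟩
        have hw : dist w z ≤ R := hw
        have h1 := im_div_exp_dist_le z w
        have hpos := w.im_pos
        rw [← ENNReal.ofReal_coe_nnreal]
        apply ENNReal.ofReal_le_ofReal
        simp only [NNReal.coe_pow, NNReal.coe_div, NNReal.coe_one, coe_nnnorm, Real.norm_eq_abs]
        refine pow_le_pow_left₀ (by positivity) ?_ 2
        change 1 / |w.im| ≤ _
        rw [abs_of_pos hpos, div_le_div_iff₀ hpos hz, one_mul]
        rw [div_le_iff₀ (Real.exp_pos _)] at h1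
        have : Real.exp (dist z w) ≤ Real.exp R := Real.exp_le_exp.2 (by rwa [dist_comm])
        nlinarith
    _ ≤ ENNReal.ofReal ((Real.exp R / z.im) ^ 2) *
        volume (Metric.closedBall (z : ℂ) (z.im * Real.exp R)) := by
        rw [setLIntegral_const]
        gcongr
    _ = ENNReal.ofReal (Real.pi * Real.exp (4 * R)) := by
        rw [Complex.volume_closedBall, ← ENNReal.ofReal_pow (by positivity),
          ← ENNReal.ofReal_coe_nnreal, ← ENNReal.ofReal_mul (by positivity),
          ← ENNReal.ofReal_mul (by positivity)]
        congr 1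
        have : Real.exp (4 * R) = Real.exp R ^ 4 := by
          rw [← Real.exp_nat_mul]; norm_num
        rw [this]
        have := hz.ne'
        simp only [NNReal.coe_real_pi]
        field_simp
    _ ≤ _ := by
        apply ENNReal.ofReal_le_ofReal
        have := Real.pi_le_four
        gcongr

/-- The ball contains a Euclidean rectangle resting at the height of `z`, of width `2 * s * z.im`
and height `h * z.im`; the density there is smallest along the top edge. -/
theorem le_volume_ball (z : ℍ) {R s h : ℝ} (hR : 0 < R) (hs : 0 ≤ s) (hh : 0 ≤ h)
    (hsh : (s ^ 2 + h ^ 2) / 2 < Real.cosh R - 1) :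
    ENNReal.ofReal (2 * s * h / (1 + h) ^ 2) ≤ volume (Metric.ball z R) := by
  have hz := z.im_pos
  set Q : Set ℂ := Set.Icc (z.re - z.im * s) (z.re + z.im * s) ×ℂ
    Set.Icc z.im (z.im * (1 + h)) with hQ
  have hvol : volume Q = ENNReal.ofReal (2 * s * h * z.im ^ 2) := by
    rw [hQ, ← Complex.volume_preserving_equiv_real_prod.symm.measure_preimage_equiv]
    have : (Complex.measurableEquivRealProd.symm ⁻¹' (Set.Icc (z.re - z.im * s)
        (z.re + z.im * s) ×ℂ Set.Icc z.im (z.im * (1 + h)))) =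
        Set.Icc (z.re - z.im * s) (z.re + z.im * s) ×ˢ Set.Icc z.im (z.im * (1 + h)) := by
      ext p
      simp [Complex.mem_reProdIm, Set.mem_prod, -Set.Icc_prod_Icc]
    rw [this, Measure.volume_eq_prod, Measure.prod_prod, Real.volume_Icc, Real.volume_Icc,
      ← ENNReal.ofReal_mul (by nlinarith [mul_nonneg hz.le hs])]
    congr 1
    ring
  have hsub : Q ⊆ UpperHalfPlane.coe '' Metric.ball z R := by
    intro w hw
    rw [hQ, Complex.mem_reProdIm, Set.mem_Icc, Set.mem_Icc] at hw
    obtain ⟨⟨h1, h2⟩, h3, h4⟩ := hw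
    refine ⟨⟨w, hz.trans_le h3⟩, ?_, rfl⟩
    set w' : ℍ := ⟨w, hz.trans_le h3⟩ with hw'
    have hwim : w'.im = w.im := rfl
    have hwpos : 0 < w.im := hz.trans_le h3
    rw [Metric.mem_ball]
    have hc : Real.cosh (dist w' z) < Real.cosh R := by
      rw [cosh_dist, hwim]
      have hd : dist (w' : ℂ) z ^ 2 ≤ z.im ^ 2 * (s ^ 2 + h ^ 2) := by
        rw [Complex.dist_eq, ← Complex.normSq_eq_norm_sq, Complex.normSq_apply]
        have e1 : ((w' : ℂ) - z).re = w.re - z.re := rfl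
        have e2 : ((w' : ℂ) - z).im = w.im - z.im := rfl
        rw [e1, e2]
        have a1 : (w.re - z.re) * (w.re - z.re) ≤ (z.im * s) ^ 2 := by
          rw [← sq]; exact sq_le_sq' (by linarith) (by linarith)
        have a2 : (w.im - z.im) * (w.im - z.im) ≤ (z.im * h) ^ 2 := by
          rw [← sq]; exact sq_le_sq' (by nlinarith) (by linarith)
        nlinarith
      have hle : dist (w' : ℂ) z ^ 2 / (2 * w.im * z.im) ≤ (s ^ 2 + h ^ 2) / 2 := by
        rw [div_le_iff₀ (by positivity)]
        have : z.im * z.im ≤ w.im * z.im := by gcongr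
        have h0 : 0 ≤ s ^ 2 + h ^ 2 := by positivity
        nlinarith
      linarith
    rw [Real.cosh_lt_cosh, abs_of_nonneg dist_nonneg, abs_of_pos hR] at hc
    exact hc
  rw [volume_eq_lintegral]
  have hQm : MeasurableSet Q := (isClosed_Icc.reProdIm isClosed_Icc).measurableSet
  calc _ = ENNReal.ofReal ((1 / (z.im * (1 + h))) ^ 2) * volume Q := by
        rw [hvol, ← ENNReal.ofReal_mul (by positivity)]
        congr 1
        have := hz.ne'
        field_simp
    _ = ∫⁻ w in Q, ENNReal.ofReal ((1 / (z.im * (1 + h))) ^ 2) := by rw [setLIntegral_const]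
    _ ≤ ∫⁻ w in Q, ↑((1 / ‖w.im‖₊) ^ 2 : NNReal) := by
        refine setLIntegral_mono' hQm fun w hw => ?_
        rw [hQ, Complex.mem_reProdIm, Set.mem_Icc, Set.mem_Icc] at hw
        have hwpos : 0 < w.im := hz.trans_le hw.2.1
        rw [← ENNReal.ofReal_coe_nnreal]
        apply ENNReal.ofReal_le_ofReal
        simp only [NNReal.coe_pow, NNReal.coe_div, NNReal.coe_one, coe_nnnorm, Real.norm_eq_abs]
        rw [abs_of_pos hwpos]
        gcongr
        exact hw.2.2
    _ ≤ _ := lintegral_mono_set hsub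

/-- The true growth is exponential; any superlinear bound would do to beat the linear exponents in
the union bound. -/
theorem sq_div_sub_one_le_volume_ball (z : ℍ) (k : ℕ) :
    ENNReal.ofReal ((k : ℝ) ^ 2 / 64 - 1) ≤ volume (Metric.ball z ((k : ℝ) - 1)) := by
  rcases lt_or_ge k 3 with hk | hk
  · rw [ENNReal.ofReal_eq_zero.2]
    · exact zero_le
    · have : (k : ℝ) < 3 := by exact_mod_cast hk
      nlinarith [(Nat.cast_nonneg k : (0 : ℝ) ≤ k)]
  have hk' : (3 : ℝ) ≤ k := by exact_mod_cast hk
  set t : ℝ := (k + 3) / 4 with ht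
  have ht' : 3 / 2 ≤ t := by linarith
  refine le_trans (ENNReal.ofReal_le_ofReal ?_)
    (le_volume_ball z (s := t ^ 2 / 2) (h := 1) (by linarith) (by positivity) zero_le_one ?_)
  · rw [ht]
    nlinarith
  -- The choice of `t` makes `k - 1 = 4 * (t - 1)`, and `t ≤ exp (t - 1)`.
  · have h1 : t ^ 4 ≤ Real.exp (k - 1) := by
      have : Real.exp (k - 1) = Real.exp (t - 1) ^ 4 := by
        rw [← Real.exp_nat_mul]
        congr 1
        push_cast
        linarith
      rw [this]
      have := Real.add_one_le_exp (t - 1)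
      gcongr
      linarith
    have h2 : 2 * Real.cosh (k - 1) ≥ Real.exp (k - 1) := by
      rw [Real.cosh_eq]
      linarith [Real.exp_pos (-((k : ℝ) - 1))]
    have h3 : (3 / 2 : ℝ) ^ 4 ≤ t ^ 4 := by gcongr
    nlinarith

theorem volume_ball_half_ge (z : ℍ) :
    ENNReal.ofReal (1 / 16) ≤ volume (Metric.ball z (1 / 2)) := by
  refine le_trans (ENNReal.ofReal_le_ofReal ?_)
    (le_volume_ball z (R := 1 / 2) (s := 1 / 4) (h := 1 / 4) (by norm_num) (by norm_num)
      (by norm_num) ?_)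
  · norm_num
  · have h1 := Real.cosh_two_mul (1 / 4)
    have h2 := Real.cosh_sq (1 / 4)
    have h3 : (1 / 4 : ℝ) ≤ Real.sinh (1 / 4) := Real.self_le_sinh_iff.2 (by norm_num)
    norm_num at h1 ⊢
    nlinarith

end UpperHalfPlane

/-! ### Void probability and mean of a Poisson count. -/

namespace IsPoissonProcess

variable {X Ω : Type*} [MeasurableSpace X] [MeasurableSpace Ω] {ν : Measure X} {P : Measure Ω}
  {N : Ω → Set X}

theorem measure_inter_eq_empty (hN : IsPoissonProcess ν P N) {A : Set X} (hA : MeasurableSet A)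
    (hfin : ν A ≠ ⊤) :
    P {ω | N ω ∩ A = ∅} = ENNReal.ofReal (Real.exp (-(ν A).toReal)) := by
  have h : {ω | N ω ∩ A = ∅} = (fun ω => (N ω ∩ A).encard) ⁻¹' {0} := by
    ext ω
    simp
  rw [h, ← Measure.map_apply (hN.measurable_count A hA) (measurableSet_singleton _),
    hN.map_count A hA hfin, Measure.map_apply (measurable_of_countable _)
      (measurableSet_singleton _)]
  have h' : (fun k : ℕ => (k : ℕ∞)) ⁻¹' {0} = {0} := by
    ext k
    simp
  rw [h', poissonMeasure_singleton]
  simp [ENNReal.coe_toNNReal_eq_toReal]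

theorem lintegral_encard (hN : IsPoissonProcess ν P N) {A : Set X} (hA : MeasurableSet A)
    (hfin : ν A ≠ ⊤) :
    ∫⁻ ω, (((N ω ∩ A).encard : ℕ∞) : ℝ≥0∞) ∂P = ν A := by
  have hm : Measurable fun k : ℕ∞ => (k : ℝ≥0∞) := measurable_of_countable _
  rw [← lintegral_map (f := fun k : ℕ∞ => (k : ℝ≥0∞)) hm (hN.measurable_count A hA),
    hN.map_count A hA hfin, lintegral_map hm (measurable_of_countable _)]
  simp only [ENat.toENNReal_coe]
  rw [lintegral_countable']
  simp only [poissonMeasure_singleton]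
  set r : ℝ≥0 := (ν A).toNNReal
  have hr : ν A = ENNReal.ofReal r := by simp [r, hfin]
  have hsum : HasSum (fun k : ℕ => (k : ℝ) * (Real.exp (-r) * r ^ k / k.factorial)) r := by
    have h1 := (hasSum_one_poissonMeasure r).mul_left (r : ℝ)
    rw [mul_one] at h1
    -- The term at `0` vanishes; after the shift the series is `r` times the total Poisson mass.
    rw [← hasSum_nat_add_iff' 1]
    simp only [Finset.range_one, Finset.sum_singleton, Nat.cast_zero, zero_mul, sub_zero]
    refine (congrArg (HasSum · (r : ℝ)) (funext fun k => ?_)).mpr h1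
    rw [Nat.factorial_succ]
    push_cast
    field_simp
    exact pow_succ' _ _
  rw [hr]
  conv_rhs => rw [← hsum.tsum_eq]
  rw [ENNReal.ofReal_tsum_of_nonneg (fun k => by positivity) hsum.summable]
  congr 1
  ext k
  rw [ENNReal.ofReal_mul (by positivity), ENNReal.ofReal_natCast]

end IsPoissonProcess

/-! ### Nets and packing. -/

namespace Metric

theorem exists_net_pairwiseDisjoint_closedBall (X : Type*) [PseudoMetricSpace X] {ε : ℝ}
    (hε : 0 ≤ ε) :
    ∃ T : Set X, T.PairwiseDisjoint (fun x => closedBall x ε) ∧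
      ∀ x, ∃ y ∈ T, dist x y ≤ 2 * ε := by
  obtain ⟨u, -, hu, h⟩ := Vitali.exists_disjoint_subfamily_covering_enlargement
    (fun x : X => closedBall x ε) Set.univ (fun _ => 0) 2 (by norm_num) (by simp) 0 (by simp)
    (fun a _ => ⟨a, by simpa⟩)
  refine ⟨u, hu, fun x => ?_⟩
  obtain ⟨y, hy, ⟨z, hz1, hz2⟩, -⟩ := h x (Set.mem_univ x)
  refine ⟨y, hy, (dist_triangle x z y).trans ?_⟩
  rw [mem_closedBall] at hz1 hz2
  rw [dist_comm] at hz1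
  linarith

end Metric

namespace UpperHalfPlane

open Classical in
-- Packing: the disjoint half-unit balls around the counted points have area at least `1 / 16` each
-- and lie in the ball of radius `R + 1`.
theorem tsum_dist_le_of_pairwiseDisjoint {T : Set ℍ} (hTc : T.Countable)
    (hT : T.PairwiseDisjoint (fun x => Metric.closedBall x (1 / 2))) (z : ℍ) (R : ℝ) :
    ∑' w : T, (if dist z w ≤ R then 1 else 0 : ℝ≥0∞) ≤
      ENNReal.ofReal (64 * Real.exp (4 * R + 4)) := by
  have : Countable T := hTc
  have hdisj : Pairwise (Function.onFun Disjoint fun w : {w : T // dist z w ≤ R} =>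
      Metric.ball (w.1.1 : ℍ) (1 / 2)) := by
    intro a b hab
    refine (hT a.1.2 b.1.2 ?_).mono Metric.ball_subset_closedBall Metric.ball_subset_closedBall
    intro h
    exact hab (Subtype.ext (Subtype.ext h))
  have hsub : (⋃ w : {w : T // dist z w ≤ R}, Metric.ball (w.1.1 : ℍ) (1 / 2)) ⊆
      Metric.closedBall z (R + 1) := by
    refine Set.iUnion_subset fun w x hx => ?_
    have hw := w.2
    rw [Metric.mem_ball] at hx
    rw [Metric.mem_closedBall]
    have := dist_triangle x w.1.1 z
    rw [dist_comm w.1.1 z] at this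
    linarith
  have key : (∑' w : T, (if dist z w ≤ R then 1 else 0 : ℝ≥0∞)) * ENNReal.ofReal (1 / 16) ≤
      ENNReal.ofReal (4 * Real.exp (4 * (R + 1))) := by
    calc _ = ∑' w : {w : T // dist z w ≤ R}, ENNReal.ofReal (1 / 16) := by
          rw [← ENNReal.tsum_mul_right]
          change _ = ∑' w : ({w : T | dist z w ≤ R} : Set T), _
          rw [tsum_subtype {w : T | dist z w ≤ R} (fun _ => ENNReal.ofReal (1 / 16))]
          congr 1
          ext w
          by_cases h : dist z w ≤ R <;> simp [h]
      _ ≤ ∑' w : {w : T // dist z w ≤ R}, volume (Metric.ball (w.1.1 : ℍ) (1 / 2)) :=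
          ENNReal.tsum_le_tsum fun w => volume_ball_half_ge _
      _ = volume (⋃ w : {w : T // dist z w ≤ R}, Metric.ball (w.1.1 : ℍ) (1 / 2)) :=
          (measure_iUnion hdisj fun w => measurableSet_ball).symm
      _ ≤ _ := (measure_mono hsub).trans (volume_closedBall_le z (R + 1))
  have h16 : ENNReal.ofReal (1 / 16) * ENNReal.ofReal 16 = 1 := by
    rw [← ENNReal.ofReal_mul (by norm_num)]
    norm_num
  calc _ = (∑' w : T, (if dist z w ≤ R then 1 else 0 : ℝ≥0∞)) * ENNReal.ofReal (1 / 16) *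
        ENNReal.ofReal 16 := by rw [mul_assoc, h16, mul_one]
    _ ≤ ENNReal.ofReal (4 * Real.exp (4 * (R + 1))) * ENNReal.ofReal 16 := by gcongr
    _ = _ := by
        rw [← ENNReal.ofReal_mul (by positivity)]
        congr 1
        ring_nf

theorem countable_of_pairwiseDisjoint_closedBall {T : Set ℍ}
    (hT : T.PairwiseDisjoint (fun x => Metric.closedBall x (1 / 2))) : T.Countable :=
  Set.PairwiseDisjoint.countable_of_isOpen
    (hT.mono fun _ => Metric.ball_subset_closedBall) (fun _ _ => Metric.isOpen_ball)
    (fun x _ => ⟨x, Metric.mem_ball_self (by norm_num)⟩)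

end UpperHalfPlane

/-! ### Chains of disjoint empty balls. -/

section VoidChain

variable {X : Type*} [PseudoMetricSpace X]

/-- Two pairs of a centre and a size are linked if their centres are at a distance that is
at most linear in the sizes. -/
def Linked (s t : X × ℕ) : Prop := dist s.1 t.1 ≤ 5 * ((s.2 : ℝ) + t.2) + 4

/-- The open ball around the centre, of radius one less than the size. -/
def innerBall (s : X × ℕ) : Set X := Metric.ball s.1 ((s.2 : ℝ) - 1)

/-- There is a chain of `m` further pairs with centres in `T`, starting from `s` and successively
linked, whose inner balls are pairwise disjoint, disjoint from `A`, and contain no points of `S`,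
and whose sizes add up to at least `M`. The set `A` contains no points of `S` either. -/
def VoidChain (T S : Set X) : ℕ → X × ℕ → Set X → ℝ → Prop
  | 0, _, A, M => S ∩ A = ∅ ∧ M ≤ 0
  | m + 1, s, A, M => ∃ t : T × ℕ, Linked s (t.1.1, t.2) ∧ Disjoint A (innerBall (t.1.1, t.2)) ∧
      VoidChain T S m (t.1.1, t.2) (A ∪ innerBall (t.1.1, t.2)) (M - t.2)

theorem voidChain_of_list {T S : Set X} (l : List (X × ℕ)) (s : X × ℕ) (A : Set X) (M : ℝ)
    (hT : ∀ t ∈ l, t.1 ∈ T) (hl : List.IsChain Linked (s :: l))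
    (hA : S ∩ A = ∅) (hlS : ∀ t ∈ l, S ∩ innerBall t = ∅)
    (hAl : ∀ t ∈ l, Disjoint A (innerBall t))
    (hd : l.Pairwise fun t t' => Disjoint (innerBall t) (innerBall t'))
    (hM : M ≤ (l.map fun t => (t.2 : ℝ)).sum) :
    VoidChain T S l.length s A M := by
  induction l generalizing s A M with
  | nil => exact ⟨hA, by simpa using hM⟩
  | cons t l ih =>
    rw [List.isChain_cons_cons] at hl
    rw [List.pairwise_cons] at hd
    simp only [List.mem_cons, forall_eq_or_imp] at hT hlS hAl
    refine ⟨(⟨t.1, hT.1⟩, t.2), hl.1, hAl.1, ih _ _ _ hT.2 hl.2 ?_ hlS.2 ?_ hd.2 ?_⟩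
    · rw [Set.inter_union_distrib_left, hA, Set.empty_union]
      exact hlS.1
    · exact fun t' ht' => Disjoint.union_left (hAl.2 t' ht') (hd.1 t' ht')
    · simp only [List.map_cons, List.sum_cons] at hM
      linarith

/-- Each size enters the two links at its ends, with factor `5` in each; the extra term for the last
size carries the induction. -/
theorem dist_getLast_le_of_isChain_linked (l : List (X × ℕ)) (s : X × ℕ)
    (hl : List.IsChain Linked (s :: l)) :
    dist s.1 ((s :: l).getLast (List.cons_ne_nil s l)).1 +
        5 * ((s :: l).getLast (List.cons_ne_nil s l)).2 ≤
      5 * s.2 + 10 * (l.map fun t => (t.2 : ℝ)).sum + 4 * l.length := by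
  induction l generalizing s with
  | nil => simp
  | cons t l ih =>
    rw [List.isChain_cons_cons] at hl
    have h1 := ih t hl.2
    have h2 := hl.1
    unfold Linked at h2
    rw [List.getLast_cons (List.cons_ne_nil t l)]
    have h3 := dist_triangle s.1 t.1 ((t :: l).getLast (List.cons_ne_nil t l)).1
    simp only [List.map_cons, List.sum_cons, List.length_cons]
    push_cast
    linarith

end VoidChain

/-! ### Probability of a void chain. -/

/-- The factor by which one more step multiplies the bound for the probability of a chain. -/
noncomputable def chainGrowth (lam : ℝ) : ℝ≥0∞ :=
  ∑' k : ℕ, ENNReal.ofReal (64 * Real.exp (20 + 41 * k - lam * (k ^ 2 / 64 - 1)))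

theorem chainGrowth_lt_top {lam : ℝ} (hlam : 0 < lam) : chainGrowth lam < ⊤ := by
  have hle : ∀ k : ℕ, 64 * Real.exp (20 + 41 * k - lam * (k ^ 2 / 64 - 1)) ≤
      64 * Real.exp (20 + lam + 16 * 42 ^ 2 / lam) * Real.exp (-k) := by
    intro k
    rw [mul_assoc, ← Real.exp_add]
    gcongr
    -- Completing the square; `42` instead of `41` leaves the summable factor `exp (-k)`.
    have h : 42 * (k : ℝ) ≤ lam * k ^ 2 / 64 + 16 * 42 ^ 2 / lam := by
      have h0 : 0 ≤ (lam * k - 32 * 42) ^ 2 / (64 * lam) := by positivity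
      have h1 : (lam * k - 32 * 42) ^ 2 / (64 * lam) =
          lam * k ^ 2 / 64 + 16 * 42 ^ 2 / lam - 42 * k := by
        field_simp
        ring
      linarith
    linarith
  have hs : Summable fun k : ℕ => 64 * Real.exp (20 + 41 * k - lam * (k ^ 2 / 64 - 1)) :=
    Summable.of_nonneg_of_le (fun k => by positivity) hle (Real.summable_exp_neg_nat.mul_left _)
  unfold chainGrowth
  rw [← ENNReal.ofReal_tsum_of_nonneg (fun k => by positivity) hs]
  exact ENNReal.ofReal_lt_top

open UpperHalfPlane in
-- Induction on the chain length, with `A` collecting the balls already chosen, so that only the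
-- void probability of one set is needed at the end. The term `20 * s.2` pays for the choice of the
-- next centre, whose distance may grow with `s.2`.
theorem measure_voidChain_le {Ω : Type*} [MeasurableSpace Ω] {P : Measure Ω} {lam : ℝ≥0}
    {N : Ω → Set ℍ} (hN : IsPoissonProcess (lam • (volume : Measure ℍ)) P N) {T : Set ℍ}
    (hT : T.PairwiseDisjoint (fun x => Metric.closedBall x (1 / 2))) (m : ℕ) (s : ℍ × ℕ)
    (A : Set ℍ) (hA : MeasurableSet A) (hAfin : volume A ≠ ⊤) (M : ℝ) :
    P {ω | VoidChain T (N ω) m s A M} ≤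
      ENNReal.ofReal (Real.exp (-(lam * (volume A).toReal) + 20 * s.2 - M)) *
        chainGrowth lam ^ m := by
  classical
  have hTc := countable_of_pairwiseDisjoint_closedBall hT
  have : Countable T := hTc
  induction m generalizing s A M with
  | zero =>
    rw [pow_zero, mul_one]
    by_cases hM : M ≤ 0
    · simp only [VoidChain, hM, and_true]
      rw [hN.measure_inter_eq_empty hA (by simpa using ENNReal.mul_ne_top (by simp) hAfin)]
      apply ENNReal.ofReal_le_ofReal
      apply Real.exp_le_exp.2
      simp only [Measure.smul_apply, ENNReal.toReal_smul, NNReal.smul_def, smul_eq_mul]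
      have : (0 : ℝ) ≤ s.2 := by positivity
      linarith
    · simp [VoidChain, hM]
  | succ m ih =>
    have hsub : {ω | VoidChain T (N ω) (m + 1) s A M} ⊆ ⋃ t : T × ℕ, {ω | Linked s (t.1.1, t.2) ∧
        Disjoint A (innerBall (t.1.1, t.2)) ∧
        VoidChain T (N ω) m (t.1.1, t.2) (A ∪ innerBall (t.1.1, t.2)) (M - t.2)} := by
      rintro ω ⟨t, ht⟩
      exact Set.mem_iUnion.2 ⟨t, ht⟩
    -- In `21 * t.2`, `20` comes from the induction hypothesis and `1` from lowering `M` by `t.2`;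
    -- counting centres later adds another `20`, giving the `41` of `chainGrowth`.
    have hstep : ∀ t : T × ℕ, P {ω | Linked s (t.1.1, t.2) ∧
        Disjoint A (innerBall (t.1.1, t.2)) ∧
        VoidChain T (N ω) m (t.1.1, t.2) (A ∪ innerBall (t.1.1, t.2)) (M - t.2)} ≤
        (if dist s.1 t.1 ≤ 5 * ((s.2 : ℝ) + t.2) + 4 then 1 else 0 : ℝ≥0∞) *
        (ENNReal.ofReal (Real.exp (-(lam * (volume A).toReal) - M
          + (21 * t.2 - lam * (t.2 ^ 2 / 64 - 1)))) * chainGrowth lam ^ m) := by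
      intro t
      by_cases hl : Linked s (t.1.1, t.2)
      swap
      · simp [hl]
      have hl' : dist s.1 t.1 ≤ 5 * ((s.2 : ℝ) + t.2) + 4 := hl
      rw [if_pos hl', one_mul]
      by_cases hd : Disjoint A (innerBall (t.1.1, t.2))
      swap
      · simp [hd]
      simp only [hl, hd, true_and]
      have hbm : MeasurableSet (innerBall (t.1.1, t.2)) := measurableSet_ball
      have hbfin : volume (innerBall (t.1.1, t.2)) ≠ ⊤ :=
        ((measure_mono Metric.ball_subset_closedBall).trans_lt
          ((volume_closedBall_le _ _).trans_lt ENNReal.ofReal_lt_top)).ne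
      have hvol := measure_union hd hbm (μ := volume)
      refine (ih (t.1.1, t.2) (A ∪ innerBall (t.1.1, t.2)) (hA.union hbm)
        (by rw [hvol]; exact ENNReal.add_ne_top.2 ⟨hAfin, hbfin⟩) (M - t.2)).trans ?_
      gcongr
      rw [hvol, ENNReal.toReal_add hAfin hbfin]
      have h1 : (t.2 : ℝ) ^ 2 / 64 - 1 ≤ (volume (innerBall (t.1.1, t.2))).toReal :=
        (ENNReal.ofReal_le_iff_le_toReal hbfin).1 (sq_div_sub_one_le_volume_ball _ _)
      have h2 := mul_le_mul_of_nonneg_left h1 lam.2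
      simp only [NNReal.val_eq_coe] at h2
      linarith
    calc _ ≤ ∑' t : T × ℕ, _ := (measure_mono hsub).trans
          ((measure_iUnion_le _).trans (ENNReal.tsum_le_tsum hstep))
      _ = ∑' k : ℕ, (∑' w : T, (if dist s.1 w ≤ 5 * ((s.2 : ℝ) + k) + 4 then 1 else 0 : ℝ≥0∞)) *
        (ENNReal.ofReal (Real.exp (-(lam * (volume A).toReal) - M
          + (21 * k - lam * (k ^ 2 / 64 - 1)))) * chainGrowth lam ^ m) := by
          rw [ENNReal.tsum_prod (f := fun (w : T) (k : ℕ) =>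
            (if dist s.1 w ≤ 5 * ((s.2 : ℝ) + k) + 4 then 1 else 0 : ℝ≥0∞) *
            (ENNReal.ofReal (Real.exp (-(lam * (volume A).toReal) - M
              + (21 * k - lam * (k ^ 2 / 64 - 1)))) * chainGrowth lam ^ m)), ENNReal.tsum_comm]
          simp only [ENNReal.tsum_mul_right]
      _ ≤ ∑' k : ℕ, (ENNReal.ofReal (Real.exp (-(lam * (volume A).toReal) + 20 * s.2 - M)) *
        chainGrowth lam ^ m) *
          ENNReal.ofReal (64 * Real.exp (20 + 41 * k - lam * (k ^ 2 / 64 - 1))) := by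
          refine ENNReal.tsum_le_tsum fun k => ?_
          refine (mul_le_mul_left (tsum_dist_le_of_pairwiseDisjoint hTc hT s.1 _) _).trans ?_
          rw [← mul_assoc, ← ENNReal.ofReal_mul (by positivity),
            mul_right_comm (ENNReal.ofReal (Real.exp (-(lam * (volume A).toReal) + 20 * s.2 - M))),
            ← ENNReal.ofReal_mul (by positivity)]
          refine mul_le_mul_left (ENNReal.ofReal_le_ofReal ?_) _
          rw [mul_assoc, ← Real.exp_add, mul_left_comm, ← Real.exp_add]
          refine mul_le_mul_of_nonneg_left (Real.exp_le_exp.2 ?_) (by norm_num)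
          linarith
      _ = _ := by
          rw [ENNReal.tsum_mul_left, pow_succ, mul_assoc]
          rfl

/-! ### From a sequence of empty balls to a void chain. -/

namespace SimpleGraph

/-- In a graph, a sequence with equal or adjacent consecutive terms can be followed by a walk. -/
theorem exists_walk_of_forall_eq_or_adj {V : Type*} (G : SimpleGraph V) (f : ℕ → V) (n : ℕ)
    (h : ∀ i < n, f i = f (i + 1) ∨ G.Adj (f i) (f (i + 1))) :
    ∃ p : G.Walk (f 0) (f n), p.length ≤ n ∧ ∀ v ∈ p.support, ∃ i ≤ n, v = f i := by
  induction n with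
  | zero => exact ⟨.nil, le_rfl, fun v hv => ⟨0, le_rfl, by simpa using hv⟩⟩
  | succ n ih =>
    obtain ⟨p, hp, hs⟩ := ih fun i hi => h i (hi.trans n.lt_succ_self)
    have hs' : ∀ v ∈ p.support, ∃ i ≤ n + 1, v = f i := fun v hv =>
      let ⟨i, hi, hv⟩ := hs v hv
      ⟨i, hi.trans n.le_succ, hv⟩
    rcases h n n.lt_succ_self with h | h
    · rw [← h]
      exact ⟨p, hp.trans n.le_succ, hs'⟩
    · refine ⟨p.concat h, by simpa using hp, fun v hv => ?_⟩
      rw [Walk.support_concat, List.mem_append, List.mem_singleton] at hv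
      rcases hv with hv | hv
      · exact hs' v hv
      · exact ⟨n + 1, le_rfl, hv⟩

end SimpleGraph

section

variable {X : Type*} [PseudoMetricSpace X]

/-- If consecutive points `x i`, `x (i + 1)` are close to the boundary of a ball which contains no
points of `S`, then there is a chain of disjoint balls whose sizes add up to a multiple of the
distance from `x 0` to `x n`. -/
theorem exists_voidChain {T S : Set X} {n : ℕ} (hn : 0 < n) (x : ℕ → X) (a : ℕ → X × ℕ)
    (haT : ∀ i < n, (a i).1 ∈ T) (h1 : ∀ i < n, dist (x i) (a i).1 ≤ (a i).2 + 2)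
    (h2 : ∀ i < n, dist (a i).1 (x (i + 1)) ≤ (a i).2 + 2)
    (hS : ∀ i < n, S ∩ innerBall (a i) = ∅) {M : ℝ}
    (hM : 10 * M + 4 * n + 2 ≤ dist (x 0) (x n)) :
    ∃ m ≤ n, VoidChain T S m (x 0, 0) ∅ M := by
  classical
  -- Vitali is applied to closed balls of the full size, whose radii are nonnegative; they contain
  -- the inner balls.
  obtain ⟨u, hut, hu, hcov⟩ := Vitali.exists_disjoint_subfamily_covering_enlargement
    (fun s : X × ℕ => Metric.closedBall s.1 s.2) (a '' Set.Iio n) (fun s => s.2) 2 (by norm_num)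
    (fun _ _ => Nat.cast_nonneg _)
    (((Set.finite_Iio n).image a).image (fun s => (s.2 : ℝ))).bddAbove.choose
    (fun s hs => (((Set.finite_Iio n).image a).image (fun s => (s.2 : ℝ))).bddAbove.choose_spec
      ⟨s, hs, rfl⟩)
    (fun s _ => ⟨s.1, Metric.mem_closedBall_self (Nat.cast_nonneg _)⟩)
  have hf : ∀ i, ∃ b, i < n → b ∈ u ∧ dist (a i).1 b.1 ≤ 3 * b.2 ∧ ((a i).2 : ℝ) ≤ 2 * b.2 := by
    intro i
    by_cases hi : i < n
    · obtain ⟨b, hb, ⟨z, hz1, hz2⟩, hab⟩ := hcov (a i) ⟨i, hi, rfl⟩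
      refine ⟨b, fun _ => ⟨hb, ?_, hab⟩⟩
      have := dist_triangle_left (a i).1 b.1 z
      rw [Metric.mem_closedBall] at hz1 hz2
      linarith
    · exact ⟨a i, fun h => absurd h hi⟩
  choose f hf using hf
  obtain ⟨n, rfl⟩ : ∃ k, n = k + 1 := ⟨n - 1, by omega⟩
  let G : SimpleGraph (X × ℕ) := SimpleGraph.fromRel Linked
  have hsymm : ∀ s t : X × ℕ, Linked s t → Linked t s := fun s t h => by
    unfold Linked at h ⊢
    rw [dist_comm]
    linarith
  have hadj : ∀ i < n, f i = f (i + 1) ∨ G.Adj (f i) (f (i + 1)) := by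
    intro i hi
    by_cases he : f i = f (i + 1)
    · exact Or.inl he
    refine Or.inr ((SimpleGraph.fromRel_adj _ _ _).2 ⟨he, Or.inl ?_⟩)
    obtain ⟨-, hd, hk⟩ := hf i (by omega)
    obtain ⟨-, hd', hk'⟩ := hf (i + 1) (by omega)
    have e1 := h2 i (by omega)
    have e2 := h1 (i + 1) (by omega)
    have e3 := dist_triangle4 (f i).1 (a i).1 (x (i + 1)) (f (i + 1)).1
    have e4 := dist_triangle (x (i + 1)) (a (i + 1)).1 (f (i + 1)).1
    rw [dist_comm (f i).1 (a i).1] at e3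
    unfold Linked
    linarith
  -- The selected balls `f i` may repeat; bypassing loops makes them distinct, hence disjoint, and
  -- keeps consecutive ones linked.
  obtain ⟨p, hp, hps⟩ := G.exists_walk_of_forall_eq_or_adj f n hadj
  have hq := p.bypass_isPath
  have hsup : ∀ v ∈ p.bypass.support, v ∈ u := by
    intro v hv
    obtain ⟨i, hi, rfl⟩ := hps v (p.support_bypass_subset_support hv)
    exact (hf i (by omega)).1
  have hlen : p.bypass.support.length ≤ n + 1 := by
    rw [SimpleGraph.Walk.length_support]
    exact Nat.succ_le_succ (p.length_bypass_le_length.trans hp)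
  have hchain : List.IsChain Linked p.bypass.support := by
    refine p.bypass.isChain_adj_support.imp fun s t h => ?_
    rcases ((SimpleGraph.fromRel_adj _ _ _).1 h).2 with h | h
    · exact h
    · exact hsymm _ _ h
  have hne := p.bypass.support_ne_nil
  have hlast : p.bypass.support.getLast hne = f n :=
    SimpleGraph.Walk.getLast_support _
  have hhead : p.bypass.support.head hne = f 0 :=
    SimpleGraph.Walk.head_support _
  have hnodup := hq.support_nodup
  generalize p.bypass.support = l at *
  have hchain' : List.IsChain Linked ((x 0, 0) :: l) := by
    obtain ⟨b, l, rfl⟩ := List.exists_cons_of_ne_nil hne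
    refine List.isChain_cons_cons.2 ⟨?_, hchain⟩
    rw [List.head_cons] at hhead
    subst hhead
    obtain ⟨-, hd, hk⟩ := hf 0 (by omega)
    have e1 := h1 0 (by omega)
    have e2 := dist_triangle (x 0) (a 0).1 (f 0).1
    unfold Linked
    push_cast
    linarith
  have hau : ∀ b ∈ u, ∃ i < n + 1, a i = b := fun b hb => hut hb
  have hball : ∀ b : X × ℕ, innerBall b ⊆ Metric.closedBall b.1 b.2 := fun b =>
    Metric.ball_subset_closedBall.trans (Metric.closedBall_subset_closedBall (by linarith))
  refine ⟨l.length, hlen, voidChain_of_list l _ _ _ ?_ hchain' (Set.inter_empty _) ?_ ?_ ?_ ?_⟩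
  · intro t ht
    obtain ⟨i, hi, rfl⟩ := hau t (hsup t ht)
    exact haT i hi
  · intro t ht
    obtain ⟨i, hi, rfl⟩ := hau t (hsup t ht)
    exact hS i hi
  · exact fun t _ => Set.empty_disjoint _
  · refine hnodup.imp_of_mem fun {s t} hs ht hst => ?_
    exact (hu (hsup s hs) (hsup t ht) hst).mono (hball s) (hball t)
  · have e := dist_getLast_le_of_isChain_linked l _ hchain'
    rw [List.getLast_cons hne, hlast] at e
    obtain ⟨-, hd, hk⟩ := hf n (by omega)
    have e1 := h2 n (by omega)
    have e2 := dist_triangle4 (x 0) (f n).1 (a n).1 (x (n + 1))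
    rw [dist_comm (f n).1 (a n).1] at e2
    have e3 : (l.length : ℝ) ≤ n + 1 := by exact_mod_cast hlen
    push_cast at hM e
    linarith

end

/-! ### Paths in the Voronoi dual graph. -/

theorem isClosed_voronoiCell (S : Set ℍ) (p : ℍ) : IsClosed (voronoiCell S p) := by
  have : voronoiCell S p = ⋂ q ∈ S, {z | dist z p ≤ dist z q} := by
    ext z
    simp [voronoiCell]
  rw [this]
  exact isClosed_biInter fun q _ => isClosed_le (by fun_prop) (by fun_prop)

/-- Adjacent nuclei lie on the boundary of a disk without nuclei in its interior. -/
theorem exists_empty_ball_of_adj {S : Set ℍ} {p q : S} (h : (voronoiDualGraph S).Adj p q) :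
    ∃ (z : ℍ) (R : ℝ), dist z p = R ∧ dist z q = R ∧ S ∩ Metric.ball z R = ∅ := by
  obtain ⟨-, γ, -, -, hγ⟩ := h
  have hp := (isClosed_voronoiCell S p).frontier_subset (hγ 0).1
  have hq := (isClosed_voronoiCell S q).frontier_subset (hγ 0).2
  refine ⟨γ 0, dist (γ 0) p, rfl, le_antisymm (hq p p.2) (hp q q.2), ?_⟩
  rw [Set.eq_empty_iff_forall_notMem]
  rintro s ⟨hs, hb⟩
  rw [Metric.mem_ball, dist_comm] at hb
  exact (hp s hs).not_gt hb

theorem exists_voidChain_of_edist_le {S T : Set ℍ} (hT : ∀ x, ∃ y ∈ T, dist x y ≤ 1) {o v : S}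
    {r : ℕ} (hov : (voronoiDualGraph S).edist o v ≤ r) {M : ℝ} (hM0 : 0 ≤ M)
    (hM : 10 * M + 4 * r + 2 ≤ dist (o : ℍ) v) {S' : Set ℍ} (hS' : S' ⊆ S) :
    ∃ m ≤ r, VoidChain T S' m (o.1, 0) ∅ M := by
  have hne : (voronoiDualGraph S).edist o v ≠ ⊤ := ne_top_of_le_ne_top (ENat.natCast_ne_top r) hov
  obtain ⟨p, hp⟩ := SimpleGraph.exists_walk_of_edist_ne_top hne
  rw [← hp] at hov
  have hlen : p.length ≤ r := by exact_mod_cast hov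
  have hlen' : (p.length : ℝ) ≤ r := by exact_mod_cast hlen
  have hpos : 0 < p.length := by
    rw [Nat.pos_iff_ne_zero]
    intro h0
    rw [p.eq_of_length_eq_zero h0, dist_self] at hM
    have : (0 : ℝ) ≤ r := by positivity
    linarith
  have ha : ∀ i, ∃ a : ℍ × ℕ, i < p.length → a.1 ∈ T ∧
      dist (p.getVert i : ℍ) a.1 ≤ a.2 + 2 ∧ dist a.1 (p.getVert (i + 1)) ≤ a.2 + 2 ∧
      S' ∩ innerBall a = ∅ := by
    intro i
    by_cases hi : i < p.length
    swap
    · exact ⟨(o, 0), fun h => absurd h hi⟩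
    obtain ⟨z, R, h1, h2, hz⟩ := exists_empty_ball_of_adj (p.adj_getVert_succ hi)
    obtain ⟨y, hy, hzy⟩ := hT z
    have hR : 0 ≤ R := h1 ▸ dist_nonneg
    have hR1 := Nat.floor_le hR
    have hR2 := Nat.lt_floor_add_one R
    -- Moving the centre by at most `1` keeps the ball of radius `⌊R⌋₊ - 1` inside the empty disk,
    -- and both nuclei within `R + 1 < ⌊R⌋₊ + 2`.
    refine ⟨(y, ⌊R⌋₊), fun _ => ⟨hy, ?_, ?_, ?_⟩⟩
    · have := dist_triangle_left (p.getVert i : ℍ) y z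
      dsimp only
      linarith
    · have := dist_triangle_left y (p.getVert (i + 1) : ℍ) z
      dsimp only
      linarith
    · refine Set.subset_eq_empty (Set.inter_subset_inter hS' (Metric.ball_subset_ball' ?_)) hz
      rw [dist_comm]
      dsimp only
      linarith
  choose a ha using ha
  obtain ⟨m, hm, h⟩ := exists_voidChain (T := T) (S := S') hpos (fun i => (p.getVert i : ℍ)) a
    (fun i hi => (ha i hi).1) (fun i hi => (ha i hi).2.1) (fun i hi => (ha i hi).2.2.1)
    (fun i hi => (ha i hi).2.2.2) (M := M) (by
      simp only [SimpleGraph.Walk.getVert_zero, SimpleGraph.Walk.getVert_length]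
      linarith)
  simp only [SimpleGraph.Walk.getVert_zero] at h
  exact ⟨m, hm.trans hlen, h⟩

/-! ### Borel–Cantelli estimates and conclusion. -/

theorem tsum_ofReal_mul_exp_neg_ne_top (c : ℝ) (hc : 0 ≤ c) :
    ∑' r : ℕ, ENNReal.ofReal (c * Real.exp (-r)) ≠ ⊤ := by
  rw [← ENNReal.ofReal_tsum_of_nonneg (fun r => by positivity)
    (Real.summable_exp_neg_nat.mul_left c)]
  exact ENNReal.ofReal_ne_top

section

variable {Ω : Type*} [MeasurableSpace Ω] {P : Measure Ω} {lam : ℝ≥0} {N : Ω → Set ℍ}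

theorem ae_eventually_dist_le (hlam : 0 < lam)
    (hN : IsPoissonProcess (lam • (volume : Measure ℍ)) P N) (o : ℍ) :
    ∃ K : ℝ, ∀ᵐ ω ∂P, ∀ᶠ r : ℕ in Filter.atTop,
      ∀ v ∈ (voronoiDualGraph (insert o (N ω))).closedBall ⟨o, Set.mem_insert o (N ω)⟩ r,
        dist (v : ℍ) o ≤ K * r := by
  obtain ⟨T, hT, hcov⟩ := Metric.exists_net_pairwiseDisjoint_closedBall ℍ
    (ε := 1 / 2) (by norm_num)
  norm_num only [one_div] at hcov
  have ha : chainGrowth lam ≠ ⊤ := (chainGrowth_lt_top (NNReal.coe_pos.2 hlam)).ne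
  set α : ℝ := (chainGrowth lam).toReal with hα
  have hα0 : 0 ≤ α := ENNReal.toReal_nonneg
  have hle : chainGrowth lam ≤ ENNReal.ofReal (Real.exp α) := by
    rw [← ENNReal.ofReal_toReal ha]
    exact ENNReal.ofReal_le_ofReal (by linarith [Real.add_one_le_exp α])
  -- Of `(α + 2) * r`, the part `α * r` absorbs `chainGrowth lam ^ m`, one `r` the `r + 1` values of
  -- `m`, and the last leaves `exp (-r)`. The `1 / 5` cancels the `+ 2` in the distance condition,
  -- so that `K = 10 * α + 24`.
  set B : ℕ → Set Ω := fun r => ⋃ m ∈ Finset.range (r + 1),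
    {ω | VoidChain T (N ω) m (o, 0) ∅ ((α + 2) * r - 1 / 5)} with hB
  have hPB : ∀ r, P (B r) ≤ ENNReal.ofReal (Real.exp (1 / 5) * Real.exp (-r)) := by
    intro r
    calc P (B r) ≤ ∑ m ∈ Finset.range (r + 1), P {ω | VoidChain T (N ω) m (o, 0) ∅
          ((α + 2) * r - 1 / 5)} := measure_biUnion_finset_le _ _
      _ ≤ ∑ m ∈ Finset.range (r + 1), ENNReal.ofReal
          (Real.exp (-((α + 2) * r - 1 / 5) + α * r)) := by
          refine Finset.sum_le_sum fun m hm => ?_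
          have hmr : (m : ℝ) ≤ r := by
            exact_mod_cast Nat.lt_succ_iff.1 (Finset.mem_range.1 hm)
          refine (measure_voidChain_le hN hT m (o, 0) ∅ MeasurableSet.empty (by simp) _).trans ?_
          refine (mul_le_mul_right (pow_le_pow_left₀ zero_le hle m) _).trans ?_
          rw [← ENNReal.ofReal_pow (Real.exp_pos _).le, ← Real.exp_nat_mul,
            ← ENNReal.ofReal_mul (Real.exp_pos _).le, ← Real.exp_add]
          refine ENNReal.ofReal_le_ofReal (Real.exp_le_exp.2 ?_)
          simp only [measure_empty, ENNReal.toReal_zero, mul_zero, neg_zero, Nat.cast_zero]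
          nlinarith
      _ = ENNReal.ofReal ((r + 1) * Real.exp (-((α + 2) * r - 1 / 5) + α * r)) := by
          rw [Finset.sum_const, Finset.card_range, nsmul_eq_mul,
            ENNReal.ofReal_mul (by positivity)]
          congr 1
          rw [← Nat.cast_succ, ENNReal.ofReal_natCast]
      _ ≤ _ := by
          apply ENNReal.ofReal_le_ofReal
          refine (mul_le_mul_of_nonneg_right (Real.add_one_le_exp (r : ℝ))
            (Real.exp_pos _).le).trans ?_
          rw [← Real.exp_add, ← Real.exp_add]
          apply Real.exp_le_exp.2
          linarith
  refine ⟨10 * α + 24, ?_⟩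
  filter_upwards [ae_eventually_notMem (μ := P) (s := B) (ne_top_of_le_ne_top
    (tsum_ofReal_mul_exp_neg_ne_top _ (Real.exp_pos (1 / 5)).le)
    (ENNReal.tsum_le_tsum hPB))] with ω hω
  filter_upwards [hω, Filter.eventually_ge_atTop 1] with r hr hr1 v hv
  by_contra! hlt
  have hr1' : (1 : ℝ) ≤ r := by exact_mod_cast hr1
  obtain ⟨m, hm, h⟩ := exists_voidChain_of_edist_le (M := (α + 2) * r - 1 / 5) hcov hv
    (by nlinarith) (by
      change _ ≤ dist o (v : ℍ)
      rw [dist_comm]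
      linarith) (Set.subset_insert o (N ω))
  exact hr (Set.mem_biUnion (Finset.mem_coe.2 (Finset.mem_range.2 (Nat.lt_succ_of_le hm))) h)

open UpperHalfPlane in
-- Markov's inequality: the threshold exceeds the bound on the mean by a factor of order `exp r`, so
-- the exceptional probabilities are summable.
theorem ae_eventually_encard_le
    (hN : IsPoissonProcess (lam • (volume : Measure ℍ)) P N) (o : ℍ) (K : ℝ) :
    ∀ᵐ ω ∂P, ∀ᶠ r : ℕ in Filter.atTop,
      (((N ω ∩ Metric.closedBall o (K * r)).encard : ℕ∞) : ℝ≥0∞) ≤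
        ENNReal.ofReal (Real.exp ((4 * K + 1) * r)) := by
  have hP : ∀ r : ℕ, P {ω | ENNReal.ofReal (Real.exp ((4 * K + 1) * r)) ≤
      (((N ω ∩ Metric.closedBall o (K * r)).encard : ℕ∞) : ℝ≥0∞)} ≤
      ENNReal.ofReal (4 * lam * Real.exp (-r)) := by
    intro r
    have hm : MeasurableSet (Metric.closedBall o (K * r)) := Metric.isClosed_closedBall.measurableSet
    have hv := volume_closedBall_le o (K * r)
    have hν : (lam • (volume : Measure ℍ)) (Metric.closedBall o (K * r)) ≤
        ENNReal.ofReal (lam * (4 * Real.exp (4 * (K * r)))) := by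
      rw [ENNReal.ofReal_mul lam.coe_nonneg, ENNReal.ofReal_coe_nnreal]
      exact mul_le_mul_right hv _
    have hf : Measurable fun k : ℕ∞ => (k : ℝ≥0∞) := measurable_of_countable _
    refine (meas_ge_le_lintegral_div (hf.comp (hN.measurable_count _ hm)).aemeasurable
      (ENNReal.ofReal_pos.2 (Real.exp_pos _)).ne' ENNReal.ofReal_ne_top).trans ?_
    refine ENNReal.div_le_of_le_mul ?_
    refine (hN.lintegral_encard hm (ne_top_of_le_ne_top ENNReal.ofReal_ne_top hν)).le.trans ?_
    refine hν.trans ?_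
    rw [← ENNReal.ofReal_mul (by positivity), mul_assoc, ← Real.exp_add]
    apply ENNReal.ofReal_le_ofReal
    apply le_of_eq
    rw [mul_comm 4 (lam : ℝ), mul_assoc]
    congr 3
    ring
  filter_upwards [ae_eventually_notMem (μ := P) (ne_top_of_le_ne_top
    (tsum_ofReal_mul_exp_neg_ne_top _ (by positivity)) (ENNReal.tsum_le_tsum hP))] with ω hω
  filter_upwards [hω] with r hr
  exact (not_le.1 hr).le

end

theorem proposition4p3 {Ω : Type*} [MeasurableSpace Ω] (P : Measure Ω) [IsProbabilityMeasure P]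
    (lam : ℝ≥0) (hlam : 0 < lam) (o : ℍ) (N : Ω → Set ℍ)
    (hN : IsPoissonProcess (lam • (volume : Measure ℍ)) P N) :
    ∀ᵐ ω ∂P,
      Filter.limsup
        (fun r : ℕ =>
          ((((voronoiDualGraph (insert o (N ω))).closedBall
            ⟨o, Set.mem_insert o (N ω)⟩ r).encard : ℕ∞) : ℝ≥0∞) ^ (1 / (r : ℝ)))
        Filter.atTop < ⊤ := by
  obtain ⟨K, hK⟩ := ae_eventually_dist_le hlam hN o
  filter_upwards [hK, ae_eventually_encard_le hN o |K|] with ω h1 h2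
  refine lt_of_le_of_lt (Filter.limsup_le_of_le (a := ENNReal.ofReal (Real.exp (4 * |K| + 2)))
    (by isBoundedDefault) ?_) ENNReal.ofReal_lt_top
  filter_upwards [h1, h2, Filter.eventually_ge_atTop 1] with r hr1 hr2 hr
  have hr' : (1 : ℝ) ≤ r := by exact_mod_cast hr
  set b := (voronoiDualGraph (insert o (N ω))).closedBall ⟨o, Set.mem_insert o (N ω)⟩ r
  have hsub : Subtype.val '' b ⊆ insert o (N ω ∩ Metric.closedBall o (|K| * r)) := by
    rintro _ ⟨v, hv, rfl⟩
    rcases v.2 with h | h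
    · exact Or.inl h
    · refine Or.inr ⟨h, (hr1 v hv).trans ?_⟩
      gcongr
      exact le_abs_self K
  have hcard : b.encard ≤ (N ω ∩ Metric.closedBall o (|K| * r)).encard + 1 := by
    rw [← Subtype.val_injective.encard_image]
    exact (Set.encard_le_encard hsub).trans (Set.encard_insert_le _ _)
  have hbound : ((b.encard : ℕ∞) : ℝ≥0∞) ≤ ENNReal.ofReal (Real.exp ((4 * |K| + 2) * r)) := by
    calc ((b.encard : ℕ∞) : ℝ≥0∞) ≤
          (((N ω ∩ Metric.closedBall o (|K| * r)).encard + 1 : ℕ∞) : ℝ≥0∞) :=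
          ENat.toENNReal_le.2 hcard
      _ ≤ ENNReal.ofReal (Real.exp ((4 * |K| + 1) * r)) + ENNReal.ofReal 1 := by
          rw [ENat.toENNReal_add, ENat.toENNReal_one, ENNReal.ofReal_one]
          gcongr
      _ ≤ _ := by
          rw [← ENNReal.ofReal_add (Real.exp_pos _).le zero_le_one]
          apply ENNReal.ofReal_le_ofReal
          have e1 : Real.exp ((4 * |K| + 2) * r) = Real.exp ((4 * |K| + 1) * r) * Real.exp r := by
            rw [← Real.exp_add]
            ring_nf
          have e2 : 1 ≤ Real.exp ((4 * |K| + 1) * r) := Real.one_le_exp (by positivity)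
          have e3 := Real.add_one_le_exp (r : ℝ)
          rw [e1]
          nlinarith
  calc ((b.encard : ℕ∞) : ℝ≥0∞) ^ (1 / (r : ℝ)) ≤
        ENNReal.ofReal (Real.exp ((4 * |K| + 2) * r)) ^ (1 / (r : ℝ)) := by
        gcongr
    _ = ENNReal.ofReal (Real.exp (4 * |K| + 2)) := by
        rw [ENNReal.ofReal_rpow_of_pos (Real.exp_pos _), ← Real.exp_mul]
        congr 2
        field_simp
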